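/- Let $\mathbb D=\{z\in\mathbb C:|z|<1\}$ and let $\mathcal A$ be a complex unital Banach algebra with unit $1_{\mathcal A}$, $\|1_{\mathcal A}\|=1$. Let $\mathcal F=\{F_t\}_{t\ge 0}$ be a one-parameter continuous semigroup on $\mathbb D$: each $F_t:\mathbb D\to\mathbb D$ is holomorphic, $(t,z)\mapsto F_t(z)$ is continuous on $[0,\infty)\times\mathbb D$, $F_{t+s}=F_t\circ F_s$ for all $t,s\ge 0$, and $F_0(z)=z$ for all $z\in\mathbb D$. A family $\{\Gamma_t\}_{t\ge0}$ of holomorphic mappings $\Gamma_t:\mathbb D\to\mathcal A$ such that $(t,z)\mapsto\Gamma_t(z)$ is continuous on $[0,\infty)\times\mathbb D$ is called a semicocycle over $\mathcal F$ if $\Gamma_t(F_s(z))\,\Gamma_s(z)=\Gamma_{t+s}(z)$ for all $t,s\ge0$, $z\in\mathbb D$, and $\Gamma_0(z)=1_{\mathcal A}$ for all $z\in\mathbb D$. For a mapping $B:\mathbb D\to\mathcal A$ consider, for each $z\in\mathbb D$, the evolution problem $$\frac{d u(t,z)}{dt}=B(F_t(z))\,u(t,z)\quad(t\ge0),\qquad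 u(0,z)=1_{\mathcal A},\tag{$*$}$$ where derivatives at $t=0$ are one-sided. (a) Let $B:\mathbb D\to\mathcal A$ be holomorphic. Then for every $z\in\mathbb D$ problem $(*)$ has a unique solution $u(\cdot,z)$ on $[0,\infty)$, and the family $\{\Gamma_t:=u(t,\cdot)\}_{t\ge0}$ is a semicocycle over $\mathcal F$. (b) Let $\{\Gamma_t\}_{t\ge0}$ be a semicocycle over $\mathcal F$. Then for every $z\in\mathbb D$ the function $t\mapsto\Gamma_t(z)$ is differentiable on $[0,\infty)$. The mapping $B(z)=\frac{d}{dt}\Gamma_t(z)\big|_{t=0}$ is holomorphic on $\mathbb D$, and for every $z\in\mathbb D$ the function $t\mapsto\Gamma_t(z)$ is the unique solution of $(*)$ with this $B$. -/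

import Mathlib

open Set Metric

/-- A one-parameter continuous semigroup of holomorphic self-mappings of an open set `D ⊆ ℂ`.
Only the values `F t z` with `0 ≤ t` and `z ∈ D` matter. -/
structure IsHolSemigroup (D : Set ℂ) (F : ℝ → ℂ → ℂ) : Prop where
  mapsTo : ∀ t, 0 ≤ t → MapsTo (F t) D D
  holomorphic : ∀ t, 0 ≤ t → DifferentiableOn ℂ (F t) D
  continuous : ContinuousOn (fun p : ℝ × ℂ => F p.1 p.2) (Ici 0 ×ˢ D)
  add : ∀ t s, 0 ≤ t → 0 ≤ s → ∀ z ∈ D, F (t + s) z = F t (F s z)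
  zero : ∀ z ∈ D, F 0 z = z

/-- `Γ` is a holomorphic `A`-valued semicocycle over the family `F` of self-mappings of `D`.
Only the values `Γ t z` with `0 ≤ t` and `z ∈ D` matter. -/
structure IsSemicocycle {A : Type*} [NormedRing A] [NormedAlgebra ℂ A]
    (D : Set ℂ) (F : ℝ → ℂ → ℂ) (Γ : ℝ → ℂ → A) : Prop where
  holomorphic : ∀ t, 0 ≤ t → DifferentiableOn ℂ (Γ t) D
  continuous : ContinuousOn (fun p : ℝ × ℂ => Γ p.1 p.2) (Ici 0 ×ˢ D)
  chain : ∀ t s, 0 ≤ t → 0 ≤ s → ∀ z ∈ D, Γ t (F s z) * Γ s z = Γ (t + s) z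
  zero : ∀ z ∈ D, Γ 0 z = 1

/-- `v` solves `v'(t) = a(t) v(t)` for `t ≥ 0`, `v(0) = 1`; the derivative is one-sided at `t = 0`
and two-sided at every `t > 0`. -/
def SolvesEvolution {A : Type*} [NormedRing A] [NormedAlgebra ℂ A] (a v : ℝ → A) : Prop :=
  (∀ t, 0 ≤ t → HasDerivWithinAt v (a t * v t) (Ici 0) t) ∧ v 0 = 1

/-- `v` is the solution on `[0, ∞)` of `v'(t) = a(t) v(t)`, `v(0) = 1`, and the only one there. -/
def IsUniqueEvolutionSolution {A : Type*} [NormedRing A] [NormedAlgebra ℂ A]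
    (a v : ℝ → A) : Prop :=
  SolvesEvolution a v ∧ ∀ w : ℝ → A, SolvesEvolution a w → EqOn w v (Ici 0)

/-- The generator `B(z) = d/dt Γ_t(z)` at `t = 0` (right derivative). -/
noncomputable def semicocycleGenerator {A : Type*} [NormedRing A] [NormedAlgebra ℂ A]
    (Γ : ℝ → ℂ → A) (z : ℂ) : A :=
  derivWithin (fun t => Γ t z) (Ici 0) 0

open Filter Topology MeasureTheory

/-! ### Time integrals of holomorphic families -/

section Parametric

variable {E : Type*}

/-! (a) For fixed `z` this is a linear equation with continuous coefficient `B (F t z)`. Its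
Peano–Baker series converges locally uniformly in `(t, z)`, so the sum is jointly continuous and
holomorphic in `z`. Solutions are unique by a Lipschitz argument, and the cocycle law is uniqueness
again: `u t (F s z) * u s z` and `u (t + s) z` solve the same problem in `t`.

(b) Differentiability at `t = 0` must come from mere continuity, and time averages provide it. With
`G z = ∫₀^ε Γ_s(z) ds`, the cocycle law gives `G(F_t z) Γ_t(z) = ∫_t^{t+ε} Γ_s(z) ds`, whose right
side is differentiable in `t`. For small `ε`, `G z` is near `ε • 1`, hence invertible, so `Γ_t(z)`
is differentiable at `0` once `F_t(z)` is. The same device treats `F`: `H z = ∫₀^ε F_s(z) ds`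
satisfies `H(F_t z) = ∫_t^{t+ε} F_s(z) ds`, and `H' z ≠ 0` makes `H` locally invertible. With `f`
the generator of `F`, this yields `B = G⁻¹ (Γ_ε - 1 - f G')`, which is holomorphic. The cocycle law
carries the right derivative to every `t`, and comparison with the Peano–Baker solution makes it
two-sided. -/

theorem continuousOn_univ_prod_iff_subtype [TopologicalSpace E] {X : Type*} [TopologicalSpace X]
    {D : Set ℂ}
    {φ : X → ℂ → E} :
    ContinuousOn (fun p : X × ℂ => φ p.1 p.2) (univ ×ˢ D) ↔
      Continuous (fun p : X × D => φ p.1 p.2) := by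
  refine ⟨fun h => h.comp_continuous (f := fun p : X × D => (p.1, (p.2 : ℂ)))
    (by fun_prop) (by simp), fun h => ?_⟩
  rw [continuousOn_iff_continuous_domRestrict]
  exact h.comp (g := fun p : X × D => φ p.1 p.2)
    (f := fun q : (univ ×ˢ D : Set (X × ℂ)) => (q.1.1, (⟨q.1.2, q.2.2⟩ : D))) (by fun_prop)

theorem ContinuousOn.continuous_left_of_univ_prod [TopologicalSpace E] {D : Set ℂ} {φ : ℝ → ℂ → E}
    (hφ : ContinuousOn (fun p : ℝ × ℂ => φ p.1 p.2) (univ ×ˢ D)) {z : ℂ} (hz : z ∈ D) :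
    Continuous (fun t => φ t z) :=
  hφ.comp_continuous (f := fun t : ℝ => (t, z)) (by fun_prop) (by simpa using hz)

variable [NormedAddCommGroup E] [NormedSpace ℂ E]

/-- Primitives in time of a jointly continuous family are jointly continuous. -/
theorem ContinuousOn.integral_zero_univ_prod {D : Set ℂ} {φ : ℝ → ℂ → E}
    (hφ : ContinuousOn (fun p : ℝ × ℂ => φ p.1 p.2) (univ ×ˢ D)) :
    ContinuousOn (fun p : ℝ × ℂ => ∫ s in (0 : ℝ)..p.1, φ s p.2) (univ ×ˢ D) := by
  rw [continuousOn_univ_prod_iff_subtype] at hφ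
  apply (continuousOn_univ_prod_iff_subtype (φ := fun t z => ∫ s in (0 : ℝ)..t, φ s z)).2
  refine intervalIntegral.continuous_parametric_intervalIntegral_of_continuous
    (f := fun (p : ℝ × D) s => φ s p.2) ?_ continuous_fst
  exact hφ.comp (f := fun q : (ℝ × D) × ℝ => (q.2, q.1.2)) (by fun_prop)

/-- The complex derivative of a jointly continuous family of holomorphic maps depends continuously
on the parameter. -/
theorem continuous_deriv_of_continuousOn_prod {D : Set ℂ} (hD : IsOpen D) {φ : ℝ → ℂ → E}
    (hφ : ContinuousOn (fun p : ℝ × ℂ => φ p.1 p.2) (univ ×ˢ D))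
    (hol : ∀ t, DifferentiableOn ℂ (φ t) D) {z : ℂ} (hz : z ∈ D) :
    Continuous (fun t => deriv (φ t) z) := by
  obtain ⟨r, hr, hrD⟩ := nhds_basis_closedBall.mem_iff.1 (hD.mem_nhds hz)
  rw [continuous_iff_continuousAt]
  intro t₀
  rw [ContinuousAt, tendsto_iff_dist_tendsto_zero, Metric.tendsto_nhds]
  intro ε hε
  -- Closeness `ε / 2 * r` on the sphere becomes `ε / 2` for derivatives, by Cauchy's estimate.
  obtain ⟨v, hv, hvε⟩ := (isCompact_sphere z r).mem_uniformity_of_prod (f := φ) (s := univ)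
    (q := t₀) (hφ.mono (prod_mono_right (sphere_subset_closedBall.trans hrD))) (mem_univ _)
    (dist_mem_uniformity (show 0 < ε / 2 * r by positivity))
  rw [nhdsWithin_univ] at hv
  filter_upwards [hv] with t ht
  have hdt : ∀ s, DifferentiableAt ℂ (φ s) z := fun s => (hol s).differentiableAt (hD.mem_nhds hz)
  have key := Complex.norm_deriv_le_of_forall_mem_sphere_norm_le (c := z) (C := ε / 2 * r)
    (f := φ t - φ t₀) hr
    ((((hol t).sub (hol t₀)).mono (closure_ball_subset_closedBall.trans hrD)).diffContOnCl)
    (fun w hw => by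
      have := hvε t ht w hw
      simp only [mem_ofPred_eq, dist_eq_norm] at this
      exact this.le)
  rw [deriv_sub (hdt t) (hdt t₀), mul_div_cancel_right₀ _ hr.ne'] at key
  rw [dist_zero_right, dist_eq_norm, norm_norm]
  linarith

/-- Differentiation under the integral sign for a jointly continuous family of holomorphic maps. -/
theorem hasDerivAt_intervalIntegral_of_continuousOn_prod {D : Set ℂ} (hD : IsOpen D)
    {φ : ℝ → ℂ → E} (hφ : ContinuousOn (fun p : ℝ × ℂ => φ p.1 p.2) (univ ×ˢ D))
    (hol : ∀ t, DifferentiableOn ℂ (φ t) D) (a b : ℝ) {z : ℂ} (hz : z ∈ D) :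
    HasDerivAt (fun w => ∫ s in a..b, φ s w) (∫ s in a..b, deriv (φ s) z) z := by
  obtain ⟨r, hr, hrD⟩ := nhds_basis_closedBall.mem_iff.1 (hD.mem_nhds hz)
  obtain ⟨C, hC⟩ := (isCompact_uIcc.prod (isCompact_closedBall z r)).exists_bound_of_continuousOn
    (hφ.mono (prod_mono (subset_univ (uIcc a b)) hrD))
  -- Halving the radius leaves room for a Cauchy estimate at every nearby `w`, giving the constant
  -- majorant `C / (r / 2)`.
  have hsub : ∀ w ∈ ball z (r / 2), closedBall w (r / 2) ⊆ closedBall z r := fun w hw =>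
    closedBall_subset_closedBall' (by linarith [mem_ball.1 hw])
  refine (intervalIntegral.hasDerivAt_integral_of_dominated_loc_of_deriv_le
    (F := fun w s => φ s w) (F' := fun w s => deriv (φ s) w) (bound := fun _ => C / (r / 2))
    (ball_mem_nhds z (half_pos hr)) ?_ ?_ ?_ ?_ ?_ ?_).2
  · filter_upwards [hD.mem_nhds hz] with w hw
    exact (hφ.continuous_left_of_univ_prod hw).aestronglyMeasurable
  · exact (hφ.continuous_left_of_univ_prod hz).intervalIntegrable _ _
  · exact (continuous_deriv_of_continuousOn_prod hD hφ hol hz).aestronglyMeasurable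
  · refine Eventually.of_forall fun s hs w hw => ?_
    refine Complex.norm_deriv_le_of_forall_mem_sphere_norm_le (half_pos hr)
      (((hol s).mono ((closure_ball_subset_closedBall.trans (hsub w hw)).trans hrD)).diffContOnCl)
      fun x hx => hC (s, x) ⟨uIoc_subset_uIcc hs, hsub w hw (sphere_subset_closedBall hx)⟩
  · exact intervalIntegrable_const
  · refine Eventually.of_forall fun s _ w hw => ((hol s).differentiableAt (hD.mem_nhds ?_)).hasDerivAt
    exact hrD (hsub w hw (mem_closedBall_self (half_pos hr).le))

theorem differentiableOn_intervalIntegral_of_continuousOn_prod {D : Set ℂ} (hD : IsOpen D)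
    {φ : ℝ → ℂ → E} (hφ : ContinuousOn (fun p : ℝ × ℂ => φ p.1 p.2) (univ ×ˢ D))
    (hol : ∀ t, DifferentiableOn ℂ (φ t) D) (a b : ℝ) :
    DifferentiableOn ℂ (fun w => ∫ s in a..b, φ s w) D := fun _ hz =>
  (hasDerivAt_intervalIntegral_of_continuousOn_prod hD hφ hol a b hz).differentiableAt
    |>.differentiableWithinAt

end Parametric

/-! ### Linear evolution equations: Peano–Baker series and uniqueness -/

section LinearEquation

variable {A : Type*} [NormedRing A] [NormedAlgebra ℂ A]

/-- The terms of the Peano–Baker series of the linear equation `v' = a v`, `v 0 = 1`. -/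
noncomputable def peanoBakerTerm (a : ℝ → ℂ → A) : ℕ → ℝ → ℂ → A
  | 0 => fun _ _ => 1
  | n + 1 => fun t z => ∫ s in (0 : ℝ)..t, a s z * peanoBakerTerm a n s z

/-- The sum of the Peano–Baker series. -/
noncomputable def peanoBaker (a : ℝ → ℂ → A) (t : ℝ) (z : ℂ) : A :=
  ∑' n, peanoBakerTerm a n t z

variable {D : Set ℂ} {a : ℝ → ℂ → A}

theorem continuousOn_peanoBakerTerm
    (ha : ContinuousOn (fun p : ℝ × ℂ => a p.1 p.2) (univ ×ˢ D)) (n : ℕ) :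
    ContinuousOn (fun p : ℝ × ℂ => peanoBakerTerm a n p.1 p.2) (univ ×ˢ D) := by
  induction n with
  | zero => exact continuousOn_const
  | succ n ih =>
    exact ContinuousOn.integral_zero_univ_prod (φ := fun s z => a s z * peanoBakerTerm a n s z)
      (ha.mul ih)

theorem differentiableOn_peanoBakerTerm (hD : IsOpen D)
    (ha : ContinuousOn (fun p : ℝ × ℂ => a p.1 p.2) (univ ×ˢ D))
    (hol : ∀ t, DifferentiableOn ℂ (a t) D) (n : ℕ) (t : ℝ) :
    DifferentiableOn ℂ (peanoBakerTerm a n t) D := by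
  induction n generalizing t with
  | zero => exact differentiableOn_const _
  | succ n ih =>
    exact differentiableOn_intervalIntegral_of_continuousOn_prod hD
      (φ := fun s z => a s z * peanoBakerTerm a n s z)
      (ha.mul (continuousOn_peanoBakerTerm ha n)) (fun s => (hol s).mul (ih s)) 0 t

theorem hasDerivAt_peanoBakerTerm_succ [CompleteSpace A]
    (ha : ContinuousOn (fun p : ℝ × ℂ => a p.1 p.2) (univ ×ˢ D)) (n : ℕ) (t : ℝ) {z : ℂ}
    (hz : z ∈ D) :
    HasDerivAt (fun t => peanoBakerTerm a (n + 1) t z) (a t z * peanoBakerTerm a n t z) t := by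
  have hc : Continuous (fun s => a s z * peanoBakerTerm a n s z) :=
    (ha.continuous_left_of_univ_prod hz).mul
      ((continuousOn_peanoBakerTerm ha n).continuous_left_of_univ_prod hz)
  exact hc.integral_hasStrictDerivAt 0 t |>.hasDerivAt

/-- Each integration of `|s| ^ n` contributes a factor `1 / (n + 1)`, whence the factorial. -/
theorem norm_peanoBakerTerm_le [NormOneClass A] {T M : ℝ} {z : ℂ} (hM : 0 ≤ M)
    (hb : ∀ s, |s| ≤ T → ‖a s z‖ ≤ M) (n : ℕ) {t : ℝ} (ht : |t| ≤ T) :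
    ‖peanoBakerTerm a n t z‖ ≤ (M * |t|) ^ n / n.factorial := by
  induction n generalizing t with
  | zero => simp [peanoBakerTerm]
  | succ n ih =>
    have hle : ∀ s ∈ uIoc 0 t, |s| ≤ T := fun s hs => by
      have := abs_sub_left_of_mem_uIcc (uIoc_subset_uIcc hs)
      simp only [sub_zero] at this
      exact this.trans ht
    have h1 : ‖∫ s in (0 : ℝ)..t, a s z * peanoBakerTerm a n s z‖ ≤
        |∫ s in (0 : ℝ)..t, M ^ (n + 1) / n.factorial * |s| ^ n| := by
      refine intervalIntegral.norm_integral_le_abs_of_norm_le ?_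
        (Continuous.intervalIntegrable (by fun_prop) _ _)
      refine (ae_restrict_iff' measurableSet_uIoc).2 (Eventually.of_forall fun s hs => ?_)
      calc ‖a s z * peanoBakerTerm a n s z‖ ≤ ‖a s z‖ * ‖peanoBakerTerm a n s z‖ := norm_mul_le _ _
        _ ≤ M * ((M * |s|) ^ n / n.factorial) :=
          mul_le_mul (hb s (hle s hs)) (ih (hle s hs)) (norm_nonneg _) hM
        _ = M ^ (n + 1) / n.factorial * |s| ^ n := by ring
    refine h1.trans_eq ?_
    have h2 := integral_pow_abs_sub_uIoc (a := 0) (b := t) (n := n)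
    simp only [sub_zero] at h2
    rw [intervalIntegral.integral_const_mul, abs_mul, intervalIntegral.abs_intervalIntegral_eq, h2,
      abs_of_nonneg (by positivity), abs_of_nonneg (by positivity), Nat.factorial_succ]
    push_cast
    field_simp
    ring

/-- A uniform summable majorant of the Peano–Baker series near each point of `ℝ × D`. -/
theorem exists_bound_peanoBakerTerm [NormOneClass A] (hD : IsOpen D)
    (ha : ContinuousOn (fun p : ℝ × ℂ => a p.1 p.2) (univ ×ˢ D)) (T : ℝ) {z : ℂ} (hz : z ∈ D) :
    ∃ r > 0, ball z r ⊆ D ∧ ∃ M : ℝ, 0 ≤ M ∧ ∀ t, |t| ≤ T → ∀ w ∈ ball z r,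
      ‖a t w‖ ≤ M ∧ ∀ n, ‖peanoBakerTerm a n t w‖ ≤ (M * T) ^ n / n.factorial := by
  obtain ⟨r, hr, hrD⟩ := nhds_basis_closedBall.mem_iff.1 (hD.mem_nhds hz)
  obtain ⟨C, hC⟩ := ((isCompact_Icc (a := -T) (b := T)).prod
    (isCompact_closedBall z r)).exists_bound_of_continuousOn
    (ha.mono (prod_mono (subset_univ _) hrD))
  refine ⟨r, hr, ball_subset_closedBall.trans hrD, max C 0, le_max_right _ _, fun t ht w hw => ?_⟩
  have hb : ∀ s, |s| ≤ T → ‖a s w‖ ≤ max C 0 := fun s hs =>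
    (hC (s, w) ⟨abs_le.1 hs, ball_subset_closedBall hw⟩).trans (le_max_left _ _)
  refine ⟨hb t ht, fun n => (norm_peanoBakerTerm_le (le_max_right _ _) hb n ht).trans ?_⟩
  gcongr

theorem continuousOn_peanoBaker [NormOneClass A] [CompleteSpace A] (hD : IsOpen D)
    (ha : ContinuousOn (fun p : ℝ × ℂ => a p.1 p.2) (univ ×ˢ D)) :
    ContinuousOn (fun p : ℝ × ℂ => peanoBaker a p.1 p.2) (univ ×ˢ D) := by
  rintro ⟨t, z⟩ ⟨-, hz⟩
  obtain ⟨r, hr, hrD, M, -, hM⟩ := exists_bound_peanoBakerTerm hD ha (|t| + 1) hz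
  have hc : ContinuousOn (fun p : ℝ × ℂ => peanoBaker a p.1 p.2) (ball 0 (|t| + 1) ×ˢ ball z r) :=
    continuousOn_tsum
      (fun n => (continuousOn_peanoBakerTerm ha n).mono (prod_mono (subset_univ _) hrD))
      (Real.summable_pow_div_factorial (M * (|t| + 1)))
      (fun n p hp => (hM p.1 (by simpa using (mem_ball.1 hp.1).le) p.2 hp.2).2 n)
  refine (hc.continuousAt ((isOpen_ball.prod isOpen_ball).mem_nhds ⟨?_, mem_ball_self hr⟩))
    |>.continuousWithinAt
  simp

theorem differentiableOn_peanoBaker [NormOneClass A] [CompleteSpace A] (hD : IsOpen D)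
    (ha : ContinuousOn (fun p : ℝ × ℂ => a p.1 p.2) (univ ×ˢ D))
    (hol : ∀ t, DifferentiableOn ℂ (a t) D) (t : ℝ) :
    DifferentiableOn ℂ (peanoBaker a t) D := by
  intro z hz
  obtain ⟨r, hr, hrD, M, -, hM⟩ := exists_bound_peanoBakerTerm hD ha |t| hz
  have hc : DifferentiableOn ℂ (peanoBaker a t) (ball z r) :=
    Complex.differentiableOn_tsum_of_summable_norm (Real.summable_pow_div_factorial (M * |t|))
      (fun n => (differentiableOn_peanoBakerTerm hD ha hol n t).mono hrD) isOpen_ball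
      (fun n w hw => (hM t le_rfl w hw).2 n)
  exact (hc.differentiableAt (ball_mem_nhds z hr)).differentiableWithinAt

@[simp]
theorem peanoBaker_zero (a : ℝ → ℂ → A) (z : ℂ) : peanoBaker a 0 z = 1 := by
  rw [peanoBaker, tsum_eq_single 0]
  · rfl
  · rintro (_ | n) hn
    · exact absurd rfl hn
    · simp [peanoBakerTerm]

theorem hasDerivAt_peanoBaker [NormOneClass A] [CompleteSpace A] (hD : IsOpen D)
    (ha : ContinuousOn (fun p : ℝ × ℂ => a p.1 p.2) (univ ×ˢ D)) (t : ℝ) {z : ℂ} (hz : z ∈ D) :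
    HasDerivAt (fun t => peanoBaker a t z) (a t z * peanoBaker a t z) t := by
  obtain ⟨r, hr, hrD, M, hM0, hM⟩ := exists_bound_peanoBakerTerm hD ha (|t| + 1) hz
  have hmem : ∀ s ∈ ball (0 : ℝ) (|t| + 1), |s| ≤ |t| + 1 := fun s hs => by
    simpa using (mem_ball.1 hs).le
  have ht : t ∈ ball (0 : ℝ) (|t| + 1) := by simp
  have hsum : ∀ s ∈ ball (0 : ℝ) (|t| + 1), Summable fun n => peanoBakerTerm a n s z :=
    fun s hs => .of_norm_bounded (Real.summable_pow_div_factorial (M * (|t| + 1)))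
      (hM s (hmem s hs) z (mem_ball_self hr)).2
  have h := hasDerivAt_tsum_of_isPreconnected
    (g := fun n s => peanoBakerTerm a (n + 1) s z)
    (g' := fun n s => a s z * peanoBakerTerm a n s z)
    ((Real.summable_pow_div_factorial (M * (|t| + 1))).mul_left M) isOpen_ball
    (convex_ball (0 : ℝ) (|t| + 1)).isPreconnected
    (fun n s _ => hasDerivAt_peanoBakerTerm_succ ha n s hz)
    (fun n s hs => (norm_mul_le _ _).trans (mul_le_mul (hM s (hmem s hs) z (mem_ball_self hr)).1
      ((hM s (hmem s hs) z (mem_ball_self hr)).2 n) (norm_nonneg _) hM0))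
    ht ((summable_nat_add_iff 1).2 (hsum t ht)) ht
  rw [(hsum t ht).tsum_mul_left] at h
  -- The constant term `1` is split off; differentiating term `n + 1` gives `a` times term `n`, so
  -- the differentiated tail is `a` times the full series.
  refine (h.const_add 1).congr_of_eventuallyEq ?_
  filter_upwards [isOpen_ball.mem_nhds ht] with s hs
  rw [peanoBaker, (hsum s hs).tsum_eq_zero_add]
  rfl

/-- Uniqueness for `v' = a v` on `[0, ∞)`, with right derivatives only. -/
theorem eqOn_Ici_of_hasDerivWithinAt_mul {a v w : ℝ → A} (ha : ContinuousOn a (Ici 0))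
    (hv : ContinuousOn v (Ici 0)) (hw : ContinuousOn w (Ici 0))
    (hv' : ∀ t, 0 ≤ t → HasDerivWithinAt v (a t * v t) (Ici t) t)
    (hw' : ∀ t, 0 ≤ t → HasDerivWithinAt w (a t * w t) (Ici t) t) (h0 : v 0 = w 0) :
    EqOn v w (Ici 0) := by
  intro T hT
  obtain ⟨C, hC⟩ := (isCompact_Icc (a := 0) (b := T)).exists_bound_of_continuousOn
    (ha.mono Icc_subset_Ici_self)
  refine ODE_solution_unique_of_mem_Icc_right (v := fun t x => a t * x) (s := fun _ => univ)
    (K := C.toNNReal) (a := 0) (b := T) (fun t ht => ?_) (hv.mono Icc_subset_Ici_self)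
    (fun t ht => hv' t ht.1) (fun _ _ => mem_univ _) (hw.mono Icc_subset_Ici_self)
    (fun t ht => hw' t ht.1) (fun _ _ => mem_univ _) h0 ⟨hT, le_rfl⟩
  refine LipschitzOnWith.of_dist_le_mul fun x _ y _ => ?_
  rw [dist_eq_norm, dist_eq_norm, ← mul_sub]
  refine (norm_mul_le _ _).trans ?_
  gcongr
  exact (hC t ⟨ht.1, ht.2.le⟩).trans (Real.le_coe_toNNReal C)

end LinearEquation

/-! ### Extension to negative times and averages over short intervals -/

section Extension

variable {E : Type*} {D : Set ℂ}

/-- Freezing the family at its time-zero value for negative times makes the two-sided calculus on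
`ℝ` available. -/
theorem ContinuousOn.comp_max_zero [TopologicalSpace E] {φ : ℝ → ℂ → E}
    (hφ : ContinuousOn (fun p : ℝ × ℂ => φ p.1 p.2) (Ici 0 ×ˢ D)) :
    ContinuousOn (fun p : ℝ × ℂ => φ (max p.1 0) p.2) (univ ×ˢ D) :=
  hφ.comp (f := fun p : ℝ × ℂ => (max p.1 0, p.2)) (by fun_prop)
    (fun p hp => ⟨le_max_right p.1 0, hp.2⟩)

theorem ContinuousOn.continuous_max_zero_left [TopologicalSpace E] {φ : ℝ → ℂ → E}
    (hφ : ContinuousOn (fun p : ℝ × ℂ => φ p.1 p.2) (Ici 0 ×ˢ D)) {z : ℂ} (hz : z ∈ D) :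
    Continuous (fun t => φ (max t 0) z) :=
  hφ.comp_continuous (f := fun t : ℝ => (max t 0, z)) (by fun_prop)
    (fun t => ⟨le_max_right t 0, hz⟩)

theorem ContinuousOn.left_of_Ici_prod [TopologicalSpace E] {φ : ℝ → ℂ → E}
    (hφ : ContinuousOn (fun p : ℝ × ℂ => φ p.1 p.2) (Ici 0 ×ˢ D)) {z : ℂ} (hz : z ∈ D) :
    ContinuousOn (fun t => φ t z) (Ici 0) :=
  hφ.comp (f := fun t : ℝ => (t, z)) (by fun_prop) (fun _ ht => ⟨ht, hz⟩)

variable [NormedAddCommGroup E] [NormedSpace ℂ E] [CompleteSpace E]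

theorem hasDerivAt_integral_window {g : ℝ → E} (hg : Continuous g) (ε : ℝ) :
    HasDerivAt (fun t => ∫ s in t..t + ε, g s) (g ε - g 0) 0 := by
  have h1 : HasDerivAt (fun t => ∫ s in (0 : ℝ)..t + ε, g s) (g ε) 0 := by
    refine HasDerivAt.comp_add_const (f := fun u => ∫ s in (0 : ℝ)..u, g s) 0 ε ?_
    simpa using (hg.integral_hasStrictDerivAt 0 ε).hasDerivAt
  have h2 := (hg.integral_hasStrictDerivAt 0 0).hasDerivAt
  refine (h1.sub h2).congr_of_eventuallyEq (Eventually.of_forall fun t => ?_)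
  exact (intervalIntegral.integral_interval_sub_left (hg.intervalIntegrable _ _)
    (hg.intervalIntegrable _ _)).symm

/-- The averages `ε⁻¹ ∫₀^ε g` tend to `g 0 = 1`, and the units form an open set. -/
theorem exists_pos_isUnit_integral {A : Type*} [NormedRing A] [NormedAlgebra ℂ A]
    [CompleteSpace A] {g : ℝ → A} (hg : Continuous g) (h0 : g 0 = 1) :
    ∃ ε > 0, IsUnit (∫ s in (0 : ℝ)..ε, g s) := by
  have h := (hg.integral_hasStrictDerivAt 0 0).hasDerivAt
  rw [h0, hasDerivAt_iff_tendsto_slope] at h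
  have h' := h.mono_left (nhdsWithin_mono (0 : ℝ) (fun x (hx : x ∈ Ioi (0 : ℝ)) => ne_of_gt hx))
  have hU : ∀ᶠ x in 𝓝 (1 : A), IsUnit x := Units.isOpen.mem_nhds isUnit_one
  obtain ⟨ε, hε, hpos⟩ := ((h'.eventually hU).and self_mem_nhdsWithin).exists
  refine ⟨ε, hpos, ?_⟩
  have hpos' : ε ≠ 0 := ne_of_gt hpos
  have hu : IsUnit (algebraMap ℝ A ε) := (IsUnit.mk0 ε hpos').map _
  convert hu.mul hε using 1
  rw [slope_def_module, ← Algebra.smul_def, intervalIntegral.integral_same, sub_zero, sub_zero,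
    smul_smul, mul_inv_cancel₀ hpos', one_smul]

end Extension

/-! ### The generator of the semigroup -/

namespace IsHolSemigroup

variable {D : Set ℂ} {F : ℝ → ℂ → ℂ}

theorem holomorphic_max (hF : IsHolSemigroup D F) (t : ℝ) :
    DifferentiableOn ℂ (fun z => F (max t 0) z) D :=
  hF.holomorphic _ (le_max_right _ _)

/-- The time average `z ↦ ∫₀^ε F_s(z) ds` intertwines the semigroup with translations in time. -/
theorem integral_comp (hF : IsHolSemigroup D F) {ε t : ℝ} (hε : 0 ≤ ε) (ht : 0 ≤ t) {z : ℂ}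
    (hz : z ∈ D) :
    ∫ s in (0 : ℝ)..ε, F (max s 0) (F t z) = ∫ s in t..t + ε, F (max s 0) z := by
  have := intervalIntegral.integral_comp_add_right (a := 0) (b := ε)
    (fun s => F (max s 0) z) t
  rw [zero_add, add_comm ε] at this
  rw [← this]
  refine intervalIntegral.integral_congr fun s hs => ?_
  rw [uIcc_of_le hε] at hs
  rw [max_eq_left hs.1, max_eq_left (add_nonneg hs.1 ht), hF.add s t hs.1 ht z hz]

theorem tendsto_nhdsWithin_zero (hF : IsHolSemigroup D F) {z : ℂ} (hz : z ∈ D) :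
    Tendsto (fun t => F t z) (𝓝[Ici 0] 0) (𝓝 z) := by
  have := (hF.continuous.left_of_Ici_prod hz) 0 self_mem_Ici
  rwa [ContinuousWithinAt, hF.zero z hz] at this

/-- Near `t = 0`, `F t z` is the local inverse of the average applied to a sliding-window integral,
so the chain rule applies. -/
theorem hasDerivWithinAt_of_deriv_integral_ne_zero (hD : IsOpen D) (hF : IsHolSemigroup D F)
    {ε : ℝ} (hε : 0 ≤ ε) {z : ℂ} (hz : z ∈ D)
    (hne : deriv (fun w => ∫ s in (0 : ℝ)..ε, F (max s 0) w) z ≠ 0) :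
    HasDerivWithinAt (fun t => F t z)
      ((F ε z - z) * (deriv (fun w => ∫ s in (0 : ℝ)..ε, F (max s 0) w) z)⁻¹) (Ici 0) 0 := by
  set H : ℂ → ℂ := fun w => ∫ s in (0 : ℝ)..ε, F (max s 0) w
  have hHd : DifferentiableOn ℂ H D := differentiableOn_intervalIntegral_of_continuousOn_prod hD
    hF.continuous.comp_max_zero hF.holomorphic_max 0 ε
  have hs : HasStrictDerivAt H (deriv H z) z :=
    (hHd.analyticAt (hD.mem_nhds hz)).hasStrictDerivAt
  have hw : HasDerivAt (fun t => ∫ s in t..t + ε, F (max s 0) z) (F ε z - z) 0 := by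
    have := hasDerivAt_integral_window
      (hF.continuous.continuous_max_zero_left hz) ε
    simpa only [max_eq_left hε, max_self, hF.zero z hz] using this
  have h0 : ∫ s in (0 : ℝ)..0 + ε, F (max s 0) z = H z := by rw [zero_add]
  have hinv : HasDerivAt (hs.localInverse H (deriv H z) z hne) (deriv H z)⁻¹
      (∫ s in (0 : ℝ)..0 + ε, F (max s 0) z) := by
    rw [h0]
    exact (hs.to_localInverse hne).hasDerivAt
  have hcomp := hinv.scomp_hasDerivWithinAt (0 : ℝ) hw.hasDerivWithinAt (s := Ici 0)
  refine hcomp.congr_of_eventuallyEq_of_mem ?_ self_mem_Ici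
  filter_upwards [(hF.tendsto_nhdsWithin_zero hz).eventually (hs.eventually_left_inverse hne),
    self_mem_nhdsWithin] with t ht ht0
  rw [Function.comp_apply, ← hF.integral_comp hε ht0 hz]
  exact ht.symm

/-- A holomorphic semigroup has a holomorphic infinitesimal generator. -/
theorem exists_generator (hD : IsOpen D) (hF : IsHolSemigroup D F) :
    ∃ f : ℂ → ℂ, DifferentiableOn ℂ f D ∧
      ∀ z ∈ D, HasDerivWithinAt (fun t => F t z) (f z) (Ici 0) 0 := by
  have key : ∀ z ∈ D, ∃ ε, 0 ≤ ε ∧ deriv (fun w => ∫ s in (0 : ℝ)..ε, F (max s 0) w) z ≠ 0 := by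
    intro z hz
    have h1 : deriv (fun w => F (max 0 0) w) z = 1 := by
      have : (fun w => F (max 0 0) w) =ᶠ[𝓝 z] id := by
        filter_upwards [hD.mem_nhds hz] with w hw
        rw [max_self]
        exact hF.zero w hw
      rw [this.deriv_eq, deriv_id]
    obtain ⟨ε, hε, hu⟩ := exists_pos_isUnit_integral (continuous_deriv_of_continuousOn_prod hD
      hF.continuous.comp_max_zero hF.holomorphic_max hz) h1
    refine ⟨ε, hε.le, ?_⟩
    rw [(hasDerivAt_intervalIntegral_of_continuousOn_prod hD
      hF.continuous.comp_max_zero hF.holomorphic_max 0 ε hz).deriv]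
    exact hu.ne_zero
  refine ⟨fun z => derivWithin (fun t => F t z) (Ici 0) 0, fun z hz => ?_, fun z hz => ?_⟩
  · obtain ⟨ε, hε, hne⟩ := key z hz
    have hH : DifferentiableOn ℂ (deriv (fun w => ∫ s in (0 : ℝ)..ε, F (max s 0) w)) D :=
      (differentiableOn_intervalIntegral_of_continuousOn_prod hD
        hF.continuous.comp_max_zero hF.holomorphic_max 0 ε).deriv hD
    have hHz := hH.differentiableAt (hD.mem_nhds hz)
    refine DifferentiableAt.differentiableWithinAt ?_
    refine DifferentiableAt.congr_of_eventuallyEq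
      ((((hF.holomorphic ε hε).differentiableAt (hD.mem_nhds hz)).sub differentiableAt_id).mul
        (hHz.inv hne)) ?_
    -- The `ε` chosen at `z` still works at nearby `w`, so one explicit formula represents the
    -- generator near `z`.
    filter_upwards [hD.mem_nhds hz, hHz.continuousAt.eventually_ne hne] with w hw hwne
    exact (hF.hasDerivWithinAt_of_deriv_integral_ne_zero hD hε hw hwne).derivWithin
      (uniqueDiffOn_Ici 0 0 self_mem_Ici)
  · obtain ⟨ε, hε, hne⟩ := key z hz
    exact (hF.hasDerivWithinAt_of_deriv_integral_ne_zero hD hε hz hne)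
      |>.differentiableWithinAt.hasDerivWithinAt

end IsHolSemigroup

/-! ### The generator of the semicocycle -/

namespace IsSemicocycle

variable {A : Type*} [NormedRing A] [NormedAlgebra ℂ A] {D : Set ℂ} {F : ℝ → ℂ → ℂ}
  {Γ : ℝ → ℂ → A}

theorem holomorphic_max (hΓ : IsSemicocycle D F Γ) (t : ℝ) :
    DifferentiableOn ℂ (fun z => Γ (max t 0) z) D :=
  hΓ.holomorphic _ (le_max_right _ _)

theorem integral_comp_mul [CompleteSpace A] (hF : IsHolSemigroup D F) (hΓ : IsSemicocycle D F Γ)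
    {ε t : ℝ} (hε : 0 ≤ ε) (ht : 0 ≤ t) {z : ℂ} (hz : z ∈ D) :
    (∫ s in (0 : ℝ)..ε, Γ (max s 0) (F t z)) * Γ t z = ∫ s in t..t + ε, Γ (max s 0) z := by
  have := intervalIntegral.integral_comp_add_right (a := 0) (b := ε)
    (fun s => Γ (max s 0) z) t
  rw [zero_add, add_comm ε] at this
  rw [← this]
  have hi : IntervalIntegrable (fun s => Γ (max s 0) (F t z)) volume 0 ε :=
    (hΓ.continuous.continuous_max_zero_left
      (hF.mapsTo t ht hz)).intervalIntegrable _ _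
  have hmul := ((ContinuousLinearMap.mul ℝ A).flip (Γ t z)).intervalIntegral_comp_comm hi
  simp only [ContinuousLinearMap.flip_apply, ContinuousLinearMap.mul_apply'] at hmul
  rw [← hmul]
  refine intervalIntegral.integral_congr fun s hs => ?_
  rw [uIcc_of_le hε] at hs
  rw [max_eq_left hs.1, max_eq_left (add_nonneg hs.1 ht), hΓ.chain s t hs.1 ht z hz]

theorem hasDerivWithinAt_of_isUnit_integral [CompleteSpace A] (hD : IsOpen D)
    (hF : IsHolSemigroup D F) (hΓ : IsSemicocycle D F Γ) {c : ℂ} {ε : ℝ} (hε : 0 ≤ ε) {z : ℂ}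
    (hz : z ∈ D) (hc : HasDerivWithinAt (fun t => F t z) c (Ici 0) 0)
    (hu : IsUnit (∫ s in (0 : ℝ)..ε, Γ (max s 0) z)) :
    HasDerivWithinAt (fun t => Γ t z)
      (Ring.inverse (∫ s in (0 : ℝ)..ε, Γ (max s 0) z) *
        (Γ ε z - 1 - c • deriv (fun w => ∫ s in (0 : ℝ)..ε, Γ (max s 0) w) z)) (Ici 0) 0 := by
  set G : ℂ → A := fun w => ∫ s in (0 : ℝ)..ε, Γ (max s 0) w
  have hGd : HasDerivAt G (deriv G z) (F 0 z) := by
    rw [hF.zero z hz]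
    exact ((differentiableOn_intervalIntegral_of_continuousOn_prod hD
      hΓ.continuous.comp_max_zero hΓ.holomorphic_max 0 ε).differentiableAt
        (hD.mem_nhds hz)).hasDerivAt
  have hGF : HasDerivWithinAt (fun t => G (F t z)) (c • deriv G z) (Ici 0) 0 :=
    HasDerivAt.scomp_hasDerivWithinAt (g₁ := G) (0 : ℝ) hGd hc
  have hw : HasDerivWithinAt (fun t => ∫ s in t..t + ε, Γ (max s 0) z) (Γ ε z - 1) (Ici 0) 0 := by
    have := hasDerivAt_integral_window
      (hΓ.continuous.continuous_max_zero_left hz) ε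
    simpa only [max_eq_left hε, max_self, hΓ.zero z hz] using this.hasDerivWithinAt
  have hu0 : IsUnit (G (F 0 z)) := by rwa [hF.zero z hz]
  have hdiff : DifferentiableWithinAt ℝ (fun t => Γ t z) (Ici 0) 0 := by
    have hinv : DifferentiableWithinAt ℝ (fun t => Ring.inverse (G (F t z))) (Ici 0) 0 :=
      DifferentiableAt.comp_differentiableWithinAt (g := Ring.inverse) (0 : ℝ)
        (differentiableAt_inverse (𝕜 := ℝ) hu0) hGF.differentiableWithinAt
    refine (hinv.mul hw.differentiableWithinAt).congr_of_eventuallyEq_of_mem ?_ self_mem_Ici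
    filter_upwards [hGF.continuousWithinAt.eventually (Units.isOpen.mem_nhds hu0),
      self_mem_nhdsWithin] with t htu ht0
    rw [Pi.mul_apply, ← hΓ.integral_comp_mul hF hε ht0 hz, Ring.inverse_mul_cancel_left _ _ htu]
  -- Differentiability being known, the product rule for `G(F_t z) Γ_t(z)` is solved for the
  -- derivative of `Γ`; the derivative of the inverse is never needed.
  have hprod := hGF.mul hdiff.hasDerivWithinAt
  have heq := (uniqueDiffOn_Ici (0 : ℝ) 0 self_mem_Ici).eq_deriv _ hprod
    (hw.congr_of_mem (fun t ht => hΓ.integral_comp_mul hF hε ht hz) self_mem_Ici)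
  rw [hΓ.zero z hz, mul_one, hF.zero z hz] at heq
  rw [← heq, add_sub_cancel_left, Ring.inverse_mul_cancel_left _ _ hu]
  exact hdiff.hasDerivWithinAt

theorem generator_spec [CompleteSpace A] (hD : IsOpen D)
    (hF : IsHolSemigroup D F) (hΓ : IsSemicocycle D F Γ) :
    DifferentiableOn ℂ (semicocycleGenerator Γ) D ∧
      ∀ z ∈ D, HasDerivWithinAt (fun t => Γ t z) (semicocycleGenerator Γ z) (Ici 0) 0 := by
  obtain ⟨f, hf, hfd⟩ := hF.exists_generator hD
  have key : ∀ z ∈ D, ∃ ε, 0 ≤ ε ∧ IsUnit (∫ s in (0 : ℝ)..ε, Γ (max s 0) z) := by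
    intro z hz
    obtain ⟨ε, hε, hu⟩ := exists_pos_isUnit_integral
      (hΓ.continuous.continuous_max_zero_left hz)
      (by rw [max_self]; exact hΓ.zero z hz)
    exact ⟨ε, hε.le, hu⟩
  refine ⟨fun z hz => ?_, fun z hz => ?_⟩
  · obtain ⟨ε, hε, hu⟩ := key z hz
    have hG : DifferentiableOn ℂ (fun w => ∫ s in (0 : ℝ)..ε, Γ (max s 0) w) D :=
      differentiableOn_intervalIntegral_of_continuousOn_prod hD
        hΓ.continuous.comp_max_zero hΓ.holomorphic_max 0 ε
    have hzD := hD.mem_nhds hz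
    have hGz := hG.differentiableAt hzD
    have hinv : DifferentiableAt ℂ
        (fun w => Ring.inverse (∫ s in (0 : ℝ)..ε, Γ (max s 0) w)) z :=
      DifferentiableAt.comp (g := Ring.inverse) z (differentiableAt_inverse (𝕜 := ℂ) hu) hGz
    refine DifferentiableAt.differentiableWithinAt ?_
    refine DifferentiableAt.congr_of_eventuallyEq (hinv.mul
      ((((hΓ.holomorphic ε hε).differentiableAt hzD).sub_const 1).sub
        ((hf.differentiableAt hzD).smul ((hG.deriv hD).differentiableAt hzD)))) ?_
    filter_upwards [hzD, hGz.continuousAt.eventually (Units.isOpen.mem_nhds hu)] with w hw hwu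
    exact (hΓ.hasDerivWithinAt_of_isUnit_integral hD hF hε hw (hfd w hw) hwu).derivWithin
      (uniqueDiffOn_Ici 0 0 self_mem_Ici)
  · obtain ⟨ε, hε, hu⟩ := key z hz
    exact (hΓ.hasDerivWithinAt_of_isUnit_integral hD hF hε hz (hfd z hz) hu)
      |>.differentiableWithinAt.hasDerivWithinAt

/-- For `s ≥ t`, `Γ_s(z) = Γ_{s-t}(F_t z) Γ_t(z)` moves the derivative at `0` to `t`. Since `s - t ≥
0` is required, only a right derivative results. -/
theorem hasDerivWithinAt_Ici [CompleteSpace A] (hD : IsOpen D)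
    (hF : IsHolSemigroup D F) (hΓ : IsSemicocycle D F Γ) {z : ℂ} (hz : z ∈ D) {t : ℝ}
    (ht : 0 ≤ t) :
    HasDerivWithinAt (fun s => Γ s z) (semicocycleGenerator Γ (F t z) * Γ t z) (Ici t) t := by
  have h := ((hΓ.generator_spec hD hF).2 _ (hF.mapsTo t ht hz)).mul_const (Γ t z)
  have h' : HasDerivWithinAt (fun s => Γ s (F t z) * Γ t z)
      (semicocycleGenerator Γ (F t z) * Γ t z) (Ici 0) (t - t) := by rwa [sub_self]
  have hs : HasDerivWithinAt (fun s : ℝ => s - t) 1 (Ici t) t :=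
    ((hasDerivAt_id t).sub_const t).hasDerivWithinAt
  have hcomp := HasDerivWithinAt.scomp (h := fun s => s - t) t h' hs (fun s (hs : t ≤ s) => sub_nonneg.2 hs)
  rw [one_smul] at hcomp
  refine hcomp.congr_of_mem (fun s (hs : t ≤ s) => ?_) self_mem_Ici
  rw [Function.comp_apply, hΓ.chain (s - t) t (sub_nonneg.2 hs) ht z hz, sub_add_cancel]

end IsSemicocycle

/-! ### The evolution problem and semicocycles -/

section Evolution

variable {A : Type*} [NormedRing A] [NormedAlgebra ℂ A]

theorem SolvesEvolution.continuousOn {a v : ℝ → A} (hv : SolvesEvolution a v) :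
    ContinuousOn v (Ici 0) := fun t ht => (hv.1 t ht).continuousWithinAt

theorem SolvesEvolution.hasDerivWithinAt_Ici {a v : ℝ → A} (hv : SolvesEvolution a v) {t : ℝ}
    (ht : 0 ≤ t) : HasDerivWithinAt v (a t * v t) (Ici t) t :=
  (hv.1 t ht).mono (Ici_subset_Ici.2 ht)

theorem SolvesEvolution.isUnique {a v : ℝ → A} (ha : ContinuousOn a (Ici 0))
    (hv : SolvesEvolution a v) : IsUniqueEvolutionSolution a v :=
  ⟨hv, fun _ hw => eqOn_Ici_of_hasDerivWithinAt_mul ha hw.continuousOn hv.continuousOn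
    (fun _ => hw.hasDerivWithinAt_Ici) (fun _ => hv.hasDerivWithinAt_Ici) (hw.2.trans hv.2.symm)⟩

theorem SolvesEvolution.congr {a v w : ℝ → A} (hv : SolvesEvolution a v)
    (h : EqOn w v (Ici 0)) : SolvesEvolution a w :=
  ⟨fun t ht => by
    rw [h ht]
    exact (hv.1 t ht).congr_of_mem h ht, (h self_mem_Ici).trans hv.2⟩

variable {D : Set ℂ} {F : ℝ → ℂ → ℂ} {B : ℂ → A}

theorem IsHolSemigroup.continuousOn_comp {E : Type*} [TopologicalSpace E] {B : ℂ → E}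
    (hF : IsHolSemigroup D F) (hB : ContinuousOn B D) :
    ContinuousOn (fun p : ℝ × ℂ => B (F p.1 p.2)) (Ici 0 ×ˢ D) :=
  hB.comp hF.continuous (fun p hp => hF.mapsTo p.1 hp.1 hp.2)

theorem IsHolSemigroup.solvesEvolution_peanoBaker [NormOneClass A] [CompleteSpace A]
    (hD : IsOpen D) (hF : IsHolSemigroup D F) (hB : ContinuousOn B D) {z : ℂ} (hz : z ∈ D) :
    SolvesEvolution (fun t => B (F t z))
      (fun t => peanoBaker (fun t z => B (F (max t 0) z)) t z) := by
  refine ⟨fun t ht => ?_, peanoBaker_zero _ _⟩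
  have hc := (hF.continuousOn_comp hB).comp_max_zero (φ := fun t z => B (F t z))
  have := hasDerivAt_peanoBaker hD (a := fun t z => B (F (max t 0) z)) hc t hz
  rw [max_eq_left ht] at this
  exact this.hasDerivWithinAt

theorem IsHolSemigroup.isSemicocycle_of_solvesEvolution [NormOneClass A] [CompleteSpace A]
    (hD : IsOpen D) (hF : IsHolSemigroup D F) (hB : DifferentiableOn ℂ B D) {u : ℝ → ℂ → A}
    (hu : ∀ z ∈ D, SolvesEvolution (fun t => B (F t z)) (fun t => u t z)) :
    IsSemicocycle D F u := by
  have hBF := hF.continuousOn_comp hB.continuousOn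
  have hBz : ∀ z ∈ D, ContinuousOn (fun t => B (F t z)) (Ici 0) := fun z hz =>
    hBF.left_of_Ici_prod (φ := fun t z => B (F t z)) hz
  have hc := hBF.comp_max_zero (φ := fun t z => B (F t z))
  have hol : ∀ t, DifferentiableOn ℂ (fun z => B (F (max t 0) z)) D := fun t =>
    hB.comp (hF.holomorphic_max t) (hF.mapsTo _ (le_max_right _ _))
  -- Nothing is assumed about how `u` depends on `z`; its regularity is inherited from the series.
  have heq : ∀ z ∈ D, ∀ t, 0 ≤ t → u t z = peanoBaker (fun t z => B (F (max t 0) z)) t z :=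
    fun z hz => ((hF.solvesEvolution_peanoBaker hD hB.continuousOn hz).isUnique (hBz z hz)).2 _
      (hu z hz)
  refine ⟨fun t ht => ?_, ?_, fun t s ht hs z hz => ?_, fun z hz => (hu z hz).2⟩
  · exact (differentiableOn_peanoBaker hD hc hol t).congr fun z hz => heq z hz t ht
  · exact ((continuousOn_peanoBaker hD hc).mono (prod_mono_left (subset_univ _))).congr
      fun p hp => heq p.2 hp.2 p.1 hp.1
  · have hsz := hF.mapsTo s hs hz
    have hmaps : MapsTo (fun t => t + s) (Ici 0) (Ici 0) := fun t ht => add_nonneg ht hs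
    refine eqOn_Ici_of_hasDerivWithinAt_mul (a := fun t => B (F t (F s z)))
      (v := fun t => u t (F s z) * u s z) (w := fun t => u (t + s) z) (hBz _ hsz)
      ((hu _ hsz).continuousOn.mul continuousOn_const)
      ((hu z hz).continuousOn.comp (by fun_prop) hmaps) (fun t ht => ?_) (fun t ht => ?_) ?_ ht
    · simpa only [mul_assoc] using ((hu _ hsz).hasDerivWithinAt_Ici ht).mul_const (u s z)
    · have h1 := (hu z hz).hasDerivWithinAt_Ici (add_nonneg ht hs)
      have h2 : HasDerivWithinAt (fun t : ℝ => t + s) 1 (Ici t) t :=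
        ((hasDerivAt_id t).add_const s).hasDerivWithinAt
      have h3 := HasDerivWithinAt.scomp (h := fun t => t + s) t h1 h2 (fun r (hr : t ≤ r) => add_le_add_left hr s)
      rw [one_smul, hF.add t s ht hs z hz] at h3
      exact h3
    · simp [(hu _ hsz).2]

/-- Uniqueness needs only right derivatives, so `Γ` equals the Peano–Baker solution, which has
two-sided ones. -/
theorem IsSemicocycle.solvesEvolution [NormOneClass A] [CompleteSpace A]
    (hD : IsOpen D) (hF : IsHolSemigroup D F) {Γ : ℝ → ℂ → A} (hΓ : IsSemicocycle D F Γ) {z : ℂ}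
    (hz : z ∈ D) :
    SolvesEvolution (fun t => semicocycleGenerator Γ (F t z)) (fun t => Γ t z) := by
  have hB := (hΓ.generator_spec hD hF).1.continuousOn
  have hp := hF.solvesEvolution_peanoBaker hD hB hz
  refine hp.congr (eqOn_Ici_of_hasDerivWithinAt_mul
    ((hF.continuousOn_comp hB).left_of_Ici_prod (φ := fun t z => semicocycleGenerator Γ (F t z)) hz)
    (hΓ.continuous.left_of_Ici_prod hz) hp.continuousOn
    (fun t ht => hΓ.hasDerivWithinAt_Ici hD hF hz ht) (fun t ht => hp.hasDerivWithinAt_Ici ht) ?_)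
  exact (hΓ.zero z hz).trans hp.2.symm

end Evolution

theorem theorem2p2 {A : Type*} [NormedRing A] [NormOneClass A] [NormedAlgebra ℂ A]
    [CompleteSpace A] (F : ℝ → ℂ → ℂ) (hF : IsHolSemigroup (ball (0 : ℂ) 1) F) :
    (∀ B : ℂ → A, DifferentiableOn ℂ B (ball (0 : ℂ) 1) →
      (∀ z ∈ ball (0 : ℂ) 1, ∃ v : ℝ → A,
        IsUniqueEvolutionSolution (fun t => B (F t z)) v) ∧
      ∀ u : ℝ → ℂ → A,
        (∀ z ∈ ball (0 : ℂ) 1, SolvesEvolution (fun t => B (F t z)) (fun t => u t z)) →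
        IsSemicocycle (ball (0 : ℂ) 1) F u) ∧
    (∀ Γ : ℝ → ℂ → A, IsSemicocycle (ball (0 : ℂ) 1) F Γ →
      (∀ z ∈ ball (0 : ℂ) 1, DifferentiableOn ℝ (fun t => Γ t z) (Ici 0)) ∧
      DifferentiableOn ℂ (semicocycleGenerator Γ) (ball (0 : ℂ) 1) ∧
      ∀ z ∈ ball (0 : ℂ) 1,
        IsUniqueEvolutionSolution (fun t => semicocycleGenerator Γ (F t z))
          (fun t => Γ t z)) := by
  have hD : IsOpen (ball (0 : ℂ) 1) := isOpen_ball
  have hcont : ∀ {B : ℂ → A}, DifferentiableOn ℂ B (ball (0 : ℂ) 1) → ∀ z ∈ ball (0 : ℂ) 1,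
      ContinuousOn (fun t => B (F t z)) (Ici 0) := fun {B} hB z hz =>
    (hF.continuousOn_comp hB.continuousOn).left_of_Ici_prod (φ := fun t z => B (F t z)) hz
  refine ⟨fun B hB => ⟨fun z hz => ?_, fun u hu => ?_⟩, fun Γ hΓ => ⟨fun z hz t ht => ?_, ?_,
    fun z hz => ?_⟩⟩
  · exact ⟨_, (hF.solvesEvolution_peanoBaker hD hB.continuousOn hz).isUnique (hcont hB z hz)⟩
  · exact hF.isSemicocycle_of_solvesEvolution hD hB hu
  · exact ((hΓ.solvesEvolution hD hF hz).1 t ht).differentiableWithinAt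
  · exact (hΓ.generator_spec hD hF).1
  · exact (hΓ.solvesEvolution hD hF hz).isUnique (hcont (hΓ.generator_spec hD hF).1 z hz)
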